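/- All vector spaces are over $\mathbb{C}$. A \emph{graded Hopf algebra} is a Hopf algebra $H = \bigoplus_{n \ge 0} H_n$ whose product, unit, coproduct, counit and antipode are graded (with $H \otimes H$ graded by $(H\otimes H)_n = \bigoplus_{i+j=n} H_i \otimes H_j$ and $\mathbb{C}$ in degree $0$). An \emph{FGCCHA} (free graded connected cocommutative Hopf algebra) is a graded cocommutative Hopf algebra $H$ that is freely generated, as an associative unital algebra, by some set $X = \biguplus_{n \ge 1} X^{(n)}$ with $X^{(n)} \subseteq H_n$ finite for every $n$ (the generators need not be primitive; $H_0 = \mathbb{C}$ follows). Homomorphisms, isomorphisms and automorphisms of FGCCHAs are those of graded Hopf algebras (degree-preserving bialgebra maps). A Hopf subalgebra of $H$ is a graded subspace that is a subalgebra, satisfies $\Delta(S) \subseteq S \otimes S$ and is closed under the antipode; it carries the induced graded Hopf algebra structure. Let $H$ and $K$ be FGCCHAs and let $f : H \to K$ be a surjective homomorphism. Then: 1. $K$ is isomorphic to a Hopf subalgebra of $H$. 2. Every surjective homomorphism $g : H \to K$ has the form $g = \gamma \circ f \circ \tau$ for some automorphism $\gamma$ of $K$ and some automorphism $\tau$ of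 $H$. -/

import Mathlib

open scoped TensorProduct

universe u v

/-- The canonical map `M ⊗ N → H ⊗ H` for subspaces `M`, `N` of `H`. -/
noncomputable abbrev tensorIncl {k : Type u} {H : Type v} [Field k] [AddCommGroup H] [Module k H]
    (M N : Submodule k H) : M ⊗[k] N →ₗ[k] H ⊗[k] H :=
  TensorProduct.map M.subtype N.subtype

/-- A Hopf subalgebra of `H`: a subalgebra `S` with `Δ(S) ⊆ S ⊗ S` and `antipode(S) ⊆ S`. -/
structure HopfSubalgebra (k : Type u) (H : Type v) [Field k] [Ring H] [HopfAlgebra k H]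
    extends Subalgebra k H where
  comul_mem' : ∀ x ∈ carrier, CoalgebraStruct.comul (R := k) x ∈
    LinearMap.range
      (tensorIncl (Subalgebra.toSubmodule toSubalgebra) (Subalgebra.toSubmodule toSubalgebra))
  antipode_mem' : ∀ x ∈ carrier, HopfAlgebraStruct.antipode k x ∈ carrier

namespace HopfSubalgebra

variable {k : Type u} {H : Type v} [Field k] [Ring H] [HopfAlgebra k H] (S : HopfSubalgebra k H)

/-- The inclusion `S → H` as a linear map. -/
def incl : S.toSubalgebra →ₗ[k] H := S.toSubalgebra.val.toLinearMap

theorem incl_apply (x : S.toSubalgebra) : S.incl x = (x : H) := rfl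

theorem incl_injective : Function.Injective S.incl := Subtype.val_injective

theorem map_incl_injective : Function.Injective (TensorProduct.map S.incl S.incl) :=
  TensorProduct.map_injective_of_flat_flat _ _ S.incl_injective S.incl_injective

theorem map_incl₃_injective :
    Function.Injective (TensorProduct.map S.incl (TensorProduct.map S.incl S.incl)) :=
  TensorProduct.map_injective_of_flat_flat _ _ S.incl_injective S.map_incl_injective

/-- The comultiplication of `H`, restricted to a map `S → S ⊗ S`. -/
noncomputable def comulRestrict :
    S.toSubalgebra →ₗ[k] S.toSubalgebra ⊗[k] S.toSubalgebra :=
  (LinearEquiv.ofInjective (TensorProduct.map S.incl S.incl)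
    S.map_incl_injective).symm.toLinearMap ∘ₗ
  LinearMap.codRestrict (LinearMap.range (TensorProduct.map S.incl S.incl))
    (CoalgebraStruct.comul (R := k) (A := H) ∘ₗ S.incl) (fun x => S.comul_mem' x.1 x.2)

theorem map_incl_comulRestrict (x : S.toSubalgebra) :
    TensorProduct.map S.incl S.incl (S.comulRestrict x) =
      CoalgebraStruct.comul (R := k) (x : H) := by
  have h := LinearEquiv.apply_symm_apply
    (LinearEquiv.ofInjective (TensorProduct.map S.incl S.incl) S.map_incl_injective)
    (LinearMap.codRestrict (LinearMap.range (TensorProduct.map S.incl S.incl))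
      (CoalgebraStruct.comul (R := k) (A := H) ∘ₗ S.incl) (fun x => S.comul_mem' x.1 x.2) x)
  exact congrArg Subtype.val h

theorem map_incl_comp_comulRestrict :
    TensorProduct.map S.incl S.incl ∘ₗ S.comulRestrict =
      CoalgebraStruct.comul (R := k) (A := H) ∘ₗ S.incl :=
  LinearMap.ext S.map_incl_comulRestrict

noncomputable instance instCoalgebra : Coalgebra k S.toSubalgebra where
  comul := S.comulRestrict
  counit := CoalgebraStruct.counit (R := k) (A := H) ∘ₗ S.incl
  coassoc := by
    ext x
    apply S.map_incl₃_injective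
    have h1 : TensorProduct.map S.incl (TensorProduct.map S.incl S.incl) ∘ₗ
        (TensorProduct.assoc k S.toSubalgebra S.toSubalgebra S.toSubalgebra).toLinearMap ∘ₗ
          S.comulRestrict.rTensor S.toSubalgebra =
        (TensorProduct.assoc k H H H).toLinearMap ∘ₗ
          (CoalgebraStruct.comul (R := k) (A := H)).rTensor H ∘ₗ
            TensorProduct.map S.incl S.incl := by
      have h0 : TensorProduct.map S.incl (TensorProduct.map S.incl S.incl) ∘ₗ
          (TensorProduct.assoc k S.toSubalgebra S.toSubalgebra S.toSubalgebra).toLinearMap =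
          (TensorProduct.assoc k H H H).toLinearMap ∘ₗ
            TensorProduct.map (TensorProduct.map S.incl S.incl) S.incl := by
        ext; rfl
      rw [← LinearMap.comp_assoc, h0]
      ext a b
      simp only [TensorProduct.AlgebraTensorModule.curry_apply, TensorProduct.curry_apply,
        LinearMap.coe_restrictScalars, LinearMap.comp_apply, LinearMap.rTensor_tmul,
        TensorProduct.map_tmul, S.map_incl_comulRestrict, S.incl_apply]
    have h2 : TensorProduct.map S.incl (TensorProduct.map S.incl S.incl) ∘ₗ
          S.comulRestrict.lTensor S.toSubalgebra =
        (CoalgebraStruct.comul (R := k) (A := H)).lTensor H ∘ₗ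
            TensorProduct.map S.incl S.incl := by
      ext a b
      simp only [TensorProduct.AlgebraTensorModule.curry_apply, TensorProduct.curry_apply,
        LinearMap.coe_restrictScalars, LinearMap.comp_apply, LinearMap.lTensor_tmul,
        TensorProduct.map_tmul, S.map_incl_comulRestrict, S.incl_apply]
    have e1 := LinearMap.congr_fun h1 (S.comulRestrict x)
    have e2 := LinearMap.congr_fun h2 (S.comulRestrict x)
    simp only [LinearMap.comp_apply, S.map_incl_comulRestrict] at e1 e2
    simp only [LinearMap.comp_apply]
    rw [e1, e2]
    exact LinearMap.congr_fun (Coalgebra.coassoc (R := k) (A := H)) (x : H)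
  rTensor_counit_comp_comul := by
    ext x
    apply TensorProduct.map_injective_of_flat_flat (LinearMap.id (R := k) (M := k)) S.incl
      Function.injective_id S.incl_injective
    have h : TensorProduct.map (LinearMap.id (R := k) (M := k)) S.incl ∘ₗ
        (CoalgebraStruct.counit (R := k) (A := H) ∘ₗ S.incl).rTensor S.toSubalgebra =
        (CoalgebraStruct.counit (R := k) (A := H)).rTensor H ∘ₗ
          TensorProduct.map S.incl S.incl := by
      ext; rfl
    have e := LinearMap.congr_fun h (S.comulRestrict x)
    simp only [LinearMap.comp_apply, S.map_incl_comulRestrict] at e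
    simp only [LinearMap.comp_apply]
    rw [e]
    exact LinearMap.congr_fun (Coalgebra.rTensor_counit_comp_comul (R := k) (A := H)) (x : H)
  lTensor_counit_comp_comul := by
    ext x
    apply TensorProduct.map_injective_of_flat_flat S.incl (LinearMap.id (R := k) (M := k))
      S.incl_injective Function.injective_id
    have h : TensorProduct.map S.incl (LinearMap.id (R := k) (M := k)) ∘ₗ
        (CoalgebraStruct.counit (R := k) (A := H) ∘ₗ S.incl).lTensor S.toSubalgebra =
        (CoalgebraStruct.counit (R := k) (A := H)).lTensor H ∘ₗ
          TensorProduct.map S.incl S.incl := by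
      ext; rfl
    have e := LinearMap.congr_fun h (S.comulRestrict x)
    simp only [LinearMap.comp_apply, S.map_incl_comulRestrict] at e
    simp only [LinearMap.comp_apply]
    rw [e]
    exact LinearMap.congr_fun (Coalgebra.lTensor_counit_comp_comul (R := k) (A := H)) (x : H)

theorem map_incl_comul (x : S.toSubalgebra) :
    TensorProduct.map S.incl S.incl (CoalgebraStruct.comul (R := k) x) =
      CoalgebraStruct.comul (R := k) (x : H) := S.map_incl_comulRestrict x

theorem counit_apply (x : S.toSubalgebra) :
    CoalgebraStruct.counit (R := k) x = CoalgebraStruct.counit (R := k) (x : H) := rfl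

theorem map_incl_mul (x y : S.toSubalgebra ⊗[k] S.toSubalgebra) :
    TensorProduct.map S.incl S.incl (x * y) =
      TensorProduct.map S.incl S.incl x * TensorProduct.map S.incl S.incl y :=
  map_mul (Algebra.TensorProduct.map S.toSubalgebra.val S.toSubalgebra.val) x y

noncomputable instance instBialgebra : Bialgebra k S.toSubalgebra :=
  Bialgebra.mk' k S.toSubalgebra
    (Bialgebra.counit_one (R := k) (A := H))
    (fun {a b} => Bialgebra.counit_mul (R := k) (a : H) (b : H))
    (by
      apply S.map_incl_injective
      rw [S.map_incl_comul]
      exact Bialgebra.comul_one (R := k) (A := H))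
    (fun {a b} => by
      apply S.map_incl_injective
      rw [S.map_incl_mul, S.map_incl_comul, S.map_incl_comul, S.map_incl_comul]
      exact Bialgebra.comul_mul (R := k) (a : H) (b : H))

/-- The antipode of `H`, restricted to `S`. -/
noncomputable def antipodeRestrict : S.toSubalgebra →ₗ[k] S.toSubalgebra :=
  LinearMap.restrict (p := Subalgebra.toSubmodule S.toSubalgebra)
    (q := Subalgebra.toSubmodule S.toSubalgebra)
    (HopfAlgebraStruct.antipode k (A := H)) S.antipode_mem'

/-- A Hopf subalgebra, with the structure maps of `H` restricted to it, is a Hopf algebra. -/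
noncomputable instance instHopfAlgebra : HopfAlgebra k S.toSubalgebra where
  antipode := S.antipodeRestrict
  mul_antipode_rTensor_comul := by
    ext x
    have h : S.incl ∘ₗ LinearMap.mul' k S.toSubalgebra ∘ₗ
        S.antipodeRestrict.rTensor S.toSubalgebra =
        LinearMap.mul' k H ∘ₗ (HopfAlgebraStruct.antipode k (A := H)).rTensor H ∘ₗ
          TensorProduct.map S.incl S.incl := by
      ext; rfl
    have e := LinearMap.congr_fun h (CoalgebraStruct.comul (R := k) x)
    simp only [LinearMap.comp_apply, S.map_incl_comul] at e
    exact e.trans (HopfAlgebra.mul_antipode_rTensor_comul_apply (R := k) (x : H))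
  mul_antipode_lTensor_comul := by
    ext x
    have h : S.incl ∘ₗ LinearMap.mul' k S.toSubalgebra ∘ₗ
        S.antipodeRestrict.lTensor S.toSubalgebra =
        LinearMap.mul' k H ∘ₗ (HopfAlgebraStruct.antipode k (A := H)).lTensor H ∘ₗ
          TensorProduct.map S.incl S.incl := by
      ext; rfl
    have e := LinearMap.congr_fun h (CoalgebraStruct.comul (R := k) x)
    simp only [LinearMap.comp_apply, S.map_incl_comul] at e
    exact e.trans (HopfAlgebra.mul_antipode_lTensor_comul_apply (R := k) (x : H))

/-- The Hopf subalgebra `S` is graded: it contains the homogeneous components of its elements,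
so that `S = ⨁ n, S ∩ H_n`. -/
def IsGraded (𝒜 : ℕ → Submodule k H) [GradedAlgebra 𝒜] : Prop :=
  DirectSum.SetLike.IsHomogeneous 𝒜 S.toSubalgebra

/-- The induced grading `n ↦ S ∩ H_n` of a Hopf subalgebra. -/
def grading (𝒜 : ℕ → Submodule k H) (n : ℕ) : Submodule k S.toSubalgebra :=
  (𝒜 n).comap S.incl

end HopfSubalgebra

/-- `𝒜` is a Hopf algebra grading of `H`: the multiplication and the unit are graded by
`GradedAlgebra 𝒜`, the remaining structure maps by the three fields. -/
structure IsGradedHopfAlgebra {H : Type v} [Ring H] [HopfAlgebra ℂ H]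
    (𝒜 : ℕ → Submodule ℂ H) [GradedAlgebra 𝒜] : Prop where
  comul_mem : ∀ n : ℕ, ∀ x ∈ 𝒜 n, CoalgebraStruct.comul (R := ℂ) x ∈
    ⨆ p ∈ Finset.HasAntidiagonal.antidiagonal n, LinearMap.range (tensorIncl (𝒜 p.1) (𝒜 p.2))
  counit_eq_zero : ∀ n : ℕ, n ≠ 0 → ∀ x ∈ 𝒜 n, CoalgebraStruct.counit (R := ℂ) x = 0
  antipode_mem : ∀ n : ℕ, ∀ x ∈ 𝒜 n, HopfAlgebraStruct.antipode ℂ x ∈ 𝒜 n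

/-- `X` is a graded free generating set of `H`, with finitely many elements in each degree: each
element of `X` is homogeneous of positive degree, and the algebra homomorphism from the free
algebra on `X` to `H` extending the inclusion is bijective. -/
structure IsGradedFreeGeneratingSet {H : Type v} [Ring H] [Algebra ℂ H]
    (𝒜 : ℕ → Submodule ℂ H) (X : Set H) : Prop where
  homogeneous : ∀ x ∈ X, ∃ n : ℕ, 1 ≤ n ∧ x ∈ 𝒜 n
  finite : ∀ n : ℕ, (X ∩ (𝒜 n : Set H)).Finite
  free : Function.Bijective (FreeAlgebra.lift ℂ (fun x : X => (x : H)))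

/-- `H`, graded by `𝒜`, is a free graded connected cocommutative Hopf algebra over `ℂ`.
Connectedness `H_0 = ℂ` holds because the free generators have positive degree. -/
structure IsFGCCHA (H : Type v) [Ring H] [HopfAlgebra ℂ H]
    (𝒜 : ℕ → Submodule ℂ H) [GradedAlgebra 𝒜] : Prop where
  graded : IsGradedHopfAlgebra 𝒜
  cocomm : Coalgebra.IsCocomm ℂ H
  free : ∃ X : Set H, IsGradedFreeGeneratingSet 𝒜 X

/-- A map between graded spaces is graded if it preserves degrees. -/
def IsGradedMap {H : Type u} {K : Type v} [AddCommGroup H] [Module ℂ H] [AddCommGroup K]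
    [Module ℂ K] (𝒜 : ℕ → Submodule ℂ H) (ℬ : ℕ → Submodule ℂ K) (f : H → K) : Prop :=
  ∀ n : ℕ, ∀ x ∈ 𝒜 n, f x ∈ ℬ n

/-!
# Surjective homomorphisms of free graded connected cocommutative Hopf algebras

Up to automorphisms, a surjection `f : H → K` is determined by `H` and `K`: for suitable free
generators `u ∪ z` of `H`, all of them primitive, `f` maps `u` to free generators of `K` and kills
`z`. Mapping `f u` back to `u` then embeds `K` in `H` as a Hopf subalgebra, and for two surjections
the two systems of generators are matched by automorphisms, because the numbers of `u` and `z` in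
each degree depend on `H` and `K` only. A map defined on primitive free generators with primitive
values is automatically a bialgebra homomorphism.

Two facts make this work.

* Primitive elements represent every class of positive degree modulo decomposables, the products of
  elements of positive degree (`exists_primitive_mkQ_eq`). The convolution product `D = S * Y` of
  the antipode with the degree operator `Y` has primitive values by cocommutativity
  (`dynkin_mem_primitives`), and `D a` is congruent to `n • a` modulo decomposables for `a` of
  degree `n` (`mkQ_dynkin`).
* A homogeneous family, finite in each degree and empty in degree 0, freely generates `H` if and
  only if its classes modulo decomposables form a basis in each positive degree
  (`IsHomogeneousFreeFamily.linearIndependent`, `IsHomogeneousFreeFamily.span_mkQ` and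
  `IsHomogeneousFreeFamily.of_linearIndependent`).

In `exists_adapted_generators`, `u` consists of primitive lifts of a basis of the indecomposables of
`K`. They give a section `s` of `f`, and subtracting `s (f a)` from a primitive element `a` shows
that the classes of primitive elements of the kernel of `f` complement those of `u`; `z` is chosen
among these.
-/

/-! ### Primitive elements -/

section Primitive

variable {k : Type*} {H K : Type*} [Field k] [Ring H] [HopfAlgebra k H] [Ring K] [HopfAlgebra k K]

variable (k H) in
/-- The subspace of primitive elements, those with `Δ x = x ⊗ 1 + 1 ⊗ x`. -/
noncomputable def primitives : Submodule k H :=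
  LinearMap.ker (CoalgebraStruct.comul (R := k) (A := H) -
    ((Algebra.TensorProduct.includeLeft : H →ₐ[k] H ⊗[k] H).toLinearMap +
      (Algebra.TensorProduct.includeRight : H →ₐ[k] H ⊗[k] H).toLinearMap))

theorem mem_primitives {x : H} :
    x ∈ primitives k H ↔ CoalgebraStruct.comul (R := k) x = x ⊗ₜ 1 + 1 ⊗ₜ x := by
  simp [primitives, sub_eq_zero]

theorem counit_eq_zero_of_mem_primitives {x : H} (hx : x ∈ primitives k H) :
    CoalgebraStruct.counit (R := k) x = 0 := by
  have h := Coalgebra.rTensor_counit_comul (R := k) x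
  rw [mem_primitives.1 hx, map_add, LinearMap.rTensor_tmul, LinearMap.rTensor_tmul,
    Bialgebra.counit_one, add_eq_right] at h
  have h2 := congrArg (LinearMap.mul' k k ∘ₗ
    (CoalgebraStruct.counit (R := k) (A := H)).lTensor k) h
  simpa using h2

theorem map_mem_primitives (f : H →ₐc[k] K) {x : H} (hx : x ∈ primitives k H) :
    f x ∈ primitives k K := by
  rw [mem_primitives, ← CoalgHomClass.map_comp_comul_apply f x, mem_primitives.1 hx]
  simp

end Primitive

/-! ### The Dynkin operator of a graded cocommutative Hopf algebra -/

section Dynkin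

variable {H : Type*} [Ring H]

/-- The degree operator of a grading: multiplication by `n` on the component of degree `n`. -/
noncomputable def degreeMap [Algebra ℂ H] (𝒜 : ℕ → Submodule ℂ H) [GradedAlgebra 𝒜] : H →ₗ[ℂ] H :=
  DirectSum.toModule ℂ ℕ H (fun n => (n : ℂ) • (𝒜 n).subtype) ∘ₗ
    (DirectSum.decomposeLinearEquiv 𝒜).toLinearMap

theorem degreeMap_of_mem [Algebra ℂ H] (𝒜 : ℕ → Submodule ℂ H) [GradedAlgebra 𝒜]
    {n : ℕ} {x : H} (hx : x ∈ 𝒜 n) : degreeMap 𝒜 x = (n : ℂ) • x := by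
  simp only [degreeMap, LinearMap.comp_apply, LinearEquiv.coe_coe,
    DirectSum.decomposeLinearEquiv_apply, DirectSum.decompose_of_mem 𝒜 hx]
  exact DirectSum.toModule_lof (M := fun n => 𝒜 n) ℂ n ⟨x, hx⟩

variable [HopfAlgebra ℂ H] (𝒜 : ℕ → Submodule ℂ H) [GradedAlgebra 𝒜]

/-- The Dynkin operator: the convolution product of the antipode with the degree operator. -/
noncomputable def dynkin : H →ₗ[ℂ] H :=
  LinearMap.mul' ℂ H ∘ₗ TensorProduct.map (HopfAlgebraStruct.antipode ℂ) (degreeMap 𝒜) ∘ₗ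
    CoalgebraStruct.comul (R := ℂ)

open WithConv

theorem toConv_dynkin :
    toConv (dynkin 𝒜) = toConv (HopfAlgebraStruct.antipode ℂ (A := H)) * toConv (degreeMap 𝒜) :=
  rfl

variable {𝒜}

/-- The degree operator is a coderivation. -/
theorem comul_degreeMap (h : IsGradedHopfAlgebra 𝒜) (x : H) :
    CoalgebraStruct.comul (R := ℂ) (degreeMap 𝒜 x) =
      ((degreeMap 𝒜).rTensor H + (degreeMap 𝒜).lTensor H)
        (CoalgebraStruct.comul (R := ℂ) x) := by
  induction x using DirectSum.Decomposition.inductionOn 𝒜 with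
  | zero => simp
  | add a b ha hb => simp only [map_add, ha, hb]
  | homogeneous x =>
    rename_i n
    rw [degreeMap_of_mem 𝒜 x.2, map_smul]
    have key : (⨆ p ∈ Finset.HasAntidiagonal.antidiagonal n,
        LinearMap.range (tensorIncl (𝒜 p.1) (𝒜 p.2))) ≤
        LinearMap.eqLocus ((n : ℂ) • (LinearMap.id : H ⊗[ℂ] H →ₗ[ℂ] H ⊗[ℂ] H))
          ((degreeMap 𝒜).rTensor H + (degreeMap 𝒜).lTensor H) := by
      refine iSup₂_le fun p hp => ?_
      rintro _ ⟨t, rfl⟩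
      induction t with
      | zero => simp
      | add a b ha hb => rw [map_add]; exact add_mem ha hb
      | tmul a b =>
        have hn : p.1 + p.2 = n := by simpa using hp
        simp only [LinearMap.mem_eqLocus, TensorProduct.map_tmul, Submodule.subtype_apply,
          LinearMap.smul_apply, LinearMap.id_apply, LinearMap.add_apply, LinearMap.rTensor_tmul,
          LinearMap.lTensor_tmul, degreeMap_of_mem 𝒜 a.2, degreeMap_of_mem 𝒜 b.2]
        rw [← hn, TensorProduct.tmul_smul, ← TensorProduct.smul_tmul',
          ← add_smul, ← Nat.cast_add]
    exact key (h.comul_mem n x x.2)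

theorem dynkin_mem (h : IsGradedHopfAlgebra 𝒜) {n : ℕ} {x : H} (hx : x ∈ 𝒜 n) :
    dynkin 𝒜 x ∈ 𝒜 n := by
  have key : (⨆ p ∈ Finset.HasAntidiagonal.antidiagonal n,
      LinearMap.range (tensorIncl (𝒜 p.1) (𝒜 p.2))) ≤
      (𝒜 n).comap (LinearMap.mul' ℂ H ∘ₗ
        TensorProduct.map (HopfAlgebraStruct.antipode ℂ) (degreeMap 𝒜)) := by
    refine iSup₂_le fun p hp => ?_
    rintro _ ⟨t, rfl⟩
    induction t with
    | zero => simp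
    | add a b ha hb => rw [map_add]; exact add_mem ha hb
    | tmul a b =>
      have hn : p.1 + p.2 = n := by simpa using hp
      simp only [Submodule.mem_comap, LinearMap.comp_apply, TensorProduct.map_tmul,
        Submodule.subtype_apply, LinearMap.mul'_apply, degreeMap_of_mem 𝒜 b.2]
      rw [← hn]
      exact SetLike.mul_mem_graded (h.antipode_mem _ _ a.2) (Submodule.smul_mem _ _ b.2)
  exact key (h.comul_mem n x hx)

/-- In the convolution algebra `Hom(H, H ⊗ H)` the comultiplication is the product of the two
inclusions `ι₁, ι₂`, whose composites commute by cocommutativity. As the degree operator `Y` is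
`id * D`, with `D` the Dynkin operator, the coderivation property gives
`Δ * (Δ ∘ D) = Δ ∘ Y = Δ * (ι₁ ∘ D + ι₂ ∘ D)`, and `Δ` is convolution invertible. -/
theorem dynkin_mem_primitives (h : IsGradedHopfAlgebra 𝒜) (hc : Coalgebra.IsCocomm ℂ H) (x : H) :
    dynkin 𝒜 x ∈ primitives ℂ H := by
  let i₁ : H →ₐ[ℂ] H ⊗[ℂ] H := Algebra.TensorProduct.includeLeft
  let i₂ : H →ₐ[ℂ] H ⊗[ℂ] H := Algebra.TensorProduct.includeRight
  let Δ : H →ₐ[ℂ] H ⊗[ℂ] H := Bialgebra.comulAlgHom ℂ H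
  let D := dynkin 𝒜
  let Y := degreeMap 𝒜
  let S := HopfAlgebraStruct.antipode ℂ (A := H)
  have hY : toConv LinearMap.id * toConv D = toConv Y := by
    rw [toConv_dynkin, ← mul_assoc, LinearMap.id_mul_antipode, one_mul]
  have comp_mul : ∀ (F : H →ₐ[ℂ] H ⊗[ℂ] H) (a b : H →ₗ[ℂ] H),
      toConv (F.toLinearMap ∘ₗ a) * toConv (F.toLinearMap ∘ₗ b) =
        toConv (F.toLinearMap ∘ₗ (toConv a * toConv b).ofConv) := fun F a b =>
    congrArg toConv (LinearMap.algHom_comp_convMul_distrib F (toConv a) (toConv b)).symm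
  have hmul : ∀ a b : H →ₗ[ℂ] H,
      toConv (i₁.toLinearMap ∘ₗ a) * toConv (i₂.toLinearMap ∘ₗ b) =
        toConv (TensorProduct.map a b ∘ₗ CoalgebraStruct.comul (R := ℂ)) := by
    intro a b
    ext y
    rw [LinearMap.convMul_apply]
    have : LinearMap.mul' ℂ (H ⊗[ℂ] H) ∘ₗ
        TensorProduct.map (i₁.toLinearMap ∘ₗ a) (i₂.toLinearMap ∘ₗ b) =
        TensorProduct.map a b := by
      ext p q; simp [i₁, i₂]
    exact LinearMap.congr_fun this _
  have hcomm : ∀ a b : H →ₗ[ℂ] H,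
      toConv (i₁.toLinearMap ∘ₗ a) * toConv (i₂.toLinearMap ∘ₗ b) =
        toConv (i₂.toLinearMap ∘ₗ b) * toConv (i₁.toLinearMap ∘ₗ a) := by
    intro a b
    ext y
    rw [LinearMap.convMul_apply, LinearMap.convMul_apply]
    have : LinearMap.mul' ℂ (H ⊗[ℂ] H) ∘ₗ
        TensorProduct.map (i₁.toLinearMap ∘ₗ a) (i₂.toLinearMap ∘ₗ b) =
        LinearMap.mul' ℂ (H ⊗[ℂ] H) ∘ₗ
        TensorProduct.map (i₂.toLinearMap ∘ₗ b) (i₁.toLinearMap ∘ₗ a) ∘ₗ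
          (TensorProduct.comm ℂ H H).toLinearMap := by
      ext p q; simp [i₁, i₂]
    refine (LinearMap.congr_fun this _).trans ?_
    simp [Coalgebra.comm_comul]
  have hΔ : toConv Δ.toLinearMap = toConv i₁.toLinearMap * toConv i₂.toLinearMap := by
    have := hmul LinearMap.id LinearMap.id
    rw [TensorProduct.map_id] at this
    exact this.symm
  have hΔY : toConv (Δ.toLinearMap ∘ₗ Y) =
      toConv (i₁.toLinearMap ∘ₗ Y) * toConv i₂.toLinearMap +
        toConv i₁.toLinearMap * toConv (i₂.toLinearMap ∘ₗ Y) := by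
    have h1 := hmul Y LinearMap.id
    have h2 := hmul LinearMap.id Y
    rw [LinearMap.comp_id] at h1 h2
    rw [h1, h2, ← toConv_add]
    congr 1
    ext y
    exact comul_degreeMap h y
  have hD1 : toConv (i₁.toLinearMap ∘ₗ Y) =
      toConv i₁.toLinearMap * toConv (i₁.toLinearMap ∘ₗ D) := by
    have := comp_mul i₁ LinearMap.id D
    rw [hY] at this
    exact this.symm
  have hD2 : toConv (i₂.toLinearMap ∘ₗ Y) =
      toConv i₂.toLinearMap * toConv (i₂.toLinearMap ∘ₗ D) := by
    have := comp_mul i₂ LinearMap.id D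
    rw [hY] at this
    exact this.symm
  have hDΔ : toConv (Δ.toLinearMap ∘ₗ Y) =
      toConv Δ.toLinearMap * toConv (Δ.toLinearMap ∘ₗ D) := by
    have := comp_mul Δ LinearMap.id D
    rw [hY] at this
    exact this.symm
  have hinv : toConv (Δ.toLinearMap ∘ₗ S) * toConv Δ.toLinearMap = 1 := by
    have := comp_mul Δ S LinearMap.id
    rw [LinearMap.antipode_mul_id, LinearMap.comp_id] at this
    rw [this]
    ext y
    simp [LinearMap.convOne_def]
  have hc2 := hcomm D LinearMap.id
  rw [LinearMap.comp_id] at hc2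
  have hfin : toConv Δ.toLinearMap * toConv (Δ.toLinearMap ∘ₗ D) =
      toConv Δ.toLinearMap *
        (toConv (i₁.toLinearMap ∘ₗ D) + toConv (i₂.toLinearMap ∘ₗ D)) := by
    rw [← hDΔ, hΔY, hD1, hD2, hΔ, mul_add, mul_assoc, hc2, mul_assoc, mul_assoc]
  have hfin2 := congrArg (toConv (Δ.toLinearMap ∘ₗ S) * ·) hfin
  simp only [← mul_assoc, hinv, one_mul] at hfin2
  rw [mem_primitives]
  exact LinearMap.congr_fun (congrArg ofConv hfin2) x

end Dynkin

/-! ### Indecomposables of a graded algebra -/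

section Indecomposables

variable {H : Type*} [Ring H] [Algebra ℂ H] (𝒜 : ℕ → Submodule ℂ H)

/-- The sum of the components of positive degree. -/
def positivePart : Submodule ℂ H := ⨆ n : ℕ, 𝒜 (n + 1)

theorem le_positivePart {n : ℕ} (hn : 0 < n) : 𝒜 n ≤ positivePart 𝒜 := by
  obtain ⟨m, rfl⟩ := Nat.exists_eq_succ_of_ne_zero hn.ne'
  exact le_iSup (fun n => 𝒜 (n + 1)) m

/-- The decomposable elements: sums of products of two elements of positive degree. -/
def decomposables : Submodule ℂ H := positivePart 𝒜 * positivePart 𝒜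

variable [GradedAlgebra 𝒜]

variable {𝒜} in
theorem decompose_mem_of_mem_decomposables {n : ℕ} {M : Submodule ℂ H}
    (hM : ∀ i j, 0 < i → 0 < j → i + j = n → 𝒜 i * 𝒜 j ≤ M)
    {x : H} (hx : x ∈ decomposables 𝒜) : (DirectSum.decompose 𝒜 x n : H) ∈ M := by
  have key : decomposables 𝒜 ≤ M.comap (GradedAlgebra.proj 𝒜 n) := by
    simp only [decomposables, positivePart, Submodule.iSup_mul, Submodule.mul_iSup]
    refine iSup_le fun j => iSup_le fun i => Submodule.mul_le.2 fun a ha b hb => ?_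
    rw [Submodule.mem_comap, GradedAlgebra.proj_apply]
    have hab := SetLike.mul_mem_graded ha hb
    by_cases h : (i + 1) + (j + 1) = n
    · rw [DirectSum.decompose_of_mem_same 𝒜 (h ▸ hab)]
      exact hM _ _ i.succ_pos j.succ_pos h (Submodule.mul_mem_mul ha hb)
    · rw [DirectSum.decompose_of_mem_ne 𝒜 hab h]
      exact zero_mem _
  exact key hx

variable {𝒜} in
/-- To write elements of `H_n` modulo decomposables it suffices to allow products `a * b` with
`deg a, deg b > 0` and `deg a + deg b = n`; this is what makes induction on the degree work. -/
theorem le_sup_of_le_sup_decomposables {n : ℕ} {E M : Submodule ℂ H} (hE : E ≤ 𝒜 n)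
    (h : 𝒜 n ≤ E ⊔ decomposables 𝒜)
    (hM : ∀ i j, 0 < i → 0 < j → i + j = n → 𝒜 i * 𝒜 j ≤ M) : 𝒜 n ≤ E ⊔ M := by
  intro x hx
  obtain ⟨e, he, d, hd, rfl⟩ := Submodule.mem_sup.1 (h hx)
  have h1 := DirectSum.decompose_of_mem_same 𝒜 hx
  rw [DirectSum.decompose_add, DirectSum.add_apply, Submodule.coe_add,
    DirectSum.decompose_of_mem_same 𝒜 (hE he)] at h1
  rw [← h1]
  exact Submodule.add_mem_sup he (decompose_mem_of_mem_decomposables hM hd)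

end Indecomposables

/-! ### Graded maps -/

section GradedMaps

variable {H K : Type*} [Ring H] [Algebra ℂ H] [Ring K] [Algebra ℂ K]
  {𝒜 : ℕ → Submodule ℂ H} {ℬ : ℕ → Submodule ℂ K}

theorem IsGradedMap.map_decomposables_le {θ : H →ₐ[ℂ] K} (h : IsGradedMap 𝒜 ℬ θ) :
    (decomposables 𝒜).map θ.toLinearMap ≤ decomposables ℬ := by
  have : (positivePart 𝒜).map θ.toLinearMap ≤ positivePart ℬ := by
    rw [positivePart, Submodule.map_iSup]
    exact iSup_mono fun n => Submodule.map_le_iff_le_comap.2 fun x hx => h _ x hx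
  rw [decomposables, Submodule.map_mul]
  exact mul_le_mul' this this

variable [GradedAlgebra 𝒜] [GradedAlgebra ℬ]

theorem IsGradedMap.map_decompose {θ : H →ₗ[ℂ] K} (h : IsGradedMap 𝒜 ℬ θ) (x : H) (n : ℕ) :
    θ (DirectSum.decompose 𝒜 x n) = DirectSum.decompose ℬ (θ x) n := by
  induction x using DirectSum.Decomposition.inductionOn 𝒜 with
  | zero => simp
  | add a b ha hb => simp [ha, hb]
  | homogeneous x =>
    rename_i m
    by_cases hmn : m = n
    · subst hmn
      rw [DirectSum.decompose_of_mem_same 𝒜 x.2, DirectSum.decompose_of_mem_same ℬ (h _ _ x.2)]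
    · rw [DirectSum.decompose_of_mem_ne 𝒜 x.2 hmn, DirectSum.decompose_of_mem_ne ℬ (h _ _ x.2) hmn,
        map_zero]

theorem IsGradedMap.exists_of_surjective {θ : H →ₗ[ℂ] K} (h : IsGradedMap 𝒜 ℬ θ)
    (hs : Function.Surjective θ) {n : ℕ} {y : K} (hy : y ∈ ℬ n) : ∃ x ∈ 𝒜 n, θ x = y := by
  obtain ⟨x, rfl⟩ := hs y
  exact ⟨_, (DirectSum.decompose 𝒜 x n).2,
    (h.map_decompose x n).trans (DirectSum.decompose_of_mem_same ℬ hy)⟩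

theorem IsGradedMap.mem_of_map_mem {θ : H →ₗ[ℂ] K} (h : IsGradedMap 𝒜 ℬ θ)
    (hi : Function.Injective θ) {n : ℕ} {x : H} (hx : θ x ∈ ℬ n) : x ∈ 𝒜 n := by
  have := h.map_decompose x n
  rw [DirectSum.decompose_of_mem_same ℬ hx] at this
  exact hi this ▸ (DirectSum.decompose 𝒜 x n).2

/-- A surjective graded endomorphism is injective if the components are finite-dimensional. -/
theorem IsGradedMap.injective_of_surjective {θ : H →ₗ[ℂ] H} (h : IsGradedMap 𝒜 𝒜 θ)
    (hfin : ∀ n, FiniteDimensional ℂ (𝒜 n)) (hs : Function.Surjective θ) :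
    Function.Injective θ := by
  rw [injective_iff_map_eq_zero]
  intro x hx
  have hinj : ∀ n, Function.Injective (θ.restrict (h n)) := fun n => by
    have := hfin n
    rw [LinearMap.injective_iff_surjective]
    rintro ⟨y, hy⟩
    obtain ⟨x, hx, hxy⟩ := h.exists_of_surjective hs hy
    exact ⟨⟨x, hx⟩, Subtype.ext hxy⟩
  have hzero : ∀ n, DirectSum.decompose 𝒜 x n = 0 := fun n => by
    apply hinj n
    apply Subtype.ext
    rw [LinearMap.coe_restrict_apply, h.map_decompose, hx]
    simp
  rw [← (DirectSum.decompose 𝒜).injective.eq_iff, DirectSum.decompose_zero]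
  exact DFinsupp.ext hzero

end GradedMaps

/-! ### Homogeneous free generators -/

section FreeGenerators

/-- The family `x n i ∈ H_n`, for `n : ℕ` and `i : κ n`, freely generates the graded algebra `H`.
The generators are indexed degree by degree, finitely many in each degree and none in degree 0. -/
structure IsHomogeneousFreeFamily {H : Type*} [Ring H] [Algebra ℂ H] (𝒜 : ℕ → Submodule ℂ H)
    {κ : ℕ → Type*} (x : ∀ n, κ n → H) : Prop where
  isEmpty_zero : IsEmpty (κ 0)
  finite : ∀ n, Finite (κ n)
  mem : ∀ n i, x n i ∈ 𝒜 n
  bijective : Function.Bijective (FreeAlgebra.lift ℂ fun i : Σ n, κ n => x i.1 i.2)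

variable {H : Type*} [Ring H] [Algebra ℂ H] {𝒜 : ℕ → Submodule ℂ H}

theorem IsGradedFreeGeneratingSet.isHomogeneousFreeFamily [GradedAlgebra 𝒜] {X : Set H}
    (hX : IsGradedFreeGeneratingSet 𝒜 X) :
    IsHomogeneousFreeFamily 𝒜 (κ := fun n => ↥(X ∩ (𝒜 n : Set H))) (fun _ x => (x : H)) := by
  have hne : ∀ x ∈ X, x ≠ 0 := fun x hx h0 => by
    apply FreeAlgebra.ι_ne_zero (R := ℂ) (⟨x, hx⟩ : X)
    apply hX.free.1
    rw [FreeAlgebra.lift_ι_apply, map_zero]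
    exact h0
  let e : (Σ n, ↥(X ∩ (𝒜 n : Set H))) ≃ X := Equiv.ofBijective (fun x => ⟨x.2, x.2.2.1⟩) <| by
    constructor
    · rintro ⟨n, x, hx, hn⟩ ⟨m, y, hy, hm⟩ h
      obtain rfl : x = y := congrArg Subtype.val h
      obtain rfl := DirectSum.degree_eq_of_mem_mem 𝒜 hn hm (hne x hx)
      rfl
    · rintro ⟨x, hx⟩
      obtain ⟨n, -, hn⟩ := hX.homogeneous x hx
      exact ⟨⟨n, x, hx, hn⟩, rfl⟩
  refine ⟨⟨?_⟩, fun n => hX.finite n, fun n x => x.2.2, ?_⟩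
  · rintro ⟨x, hx, h0⟩
    obtain ⟨n, h1, hn⟩ := hX.homogeneous x hx
    have := DirectSum.degree_eq_of_mem_mem 𝒜 hn h0 (hne x hx)
    omega
  · let E := FreeAlgebra.lift ℂ (fun i : Σ n, ↥(X ∩ (𝒜 n : Set H)) => FreeAlgebra.ι ℂ (e i))
    let E' := FreeAlgebra.lift ℂ
      (fun x : X => FreeAlgebra.ι ℂ (X := Σ n, ↥(X ∩ (𝒜 n : Set H))) (e.symm x))
    have h1 : E.comp E' = AlgHom.id ℂ _ := by ext; simp [E, E']
    have h2 : E'.comp E = AlgHom.id ℂ _ := by ext; simp [E, E']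
    have hE : Function.Bijective E := Function.bijective_iff_has_inverse.2
      ⟨E', fun a => DFunLike.congr_fun h2 a, fun a => DFunLike.congr_fun h1 a⟩
    have h3 : FreeAlgebra.lift ℂ (fun i : Σ n, ↥(X ∩ (𝒜 n : Set H)) => (i.2 : H)) =
        (FreeAlgebra.lift ℂ (fun x : X => (x : H))).comp E := by
      ext i
      simp only [Function.comp_apply, AlgHom.comp_apply, E, FreeAlgebra.lift_ι_apply]
      rfl
    rw [h3]
    exact hX.free.comp hE

namespace IsHomogeneousFreeFamily

variable {κ : ℕ → Type*} {x : ∀ n, κ n → H}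

theorem span_le (hx : IsHomogeneousFreeFamily 𝒜 x) (n : ℕ) :
    Submodule.span ℂ (Set.range (x n)) ≤ 𝒜 n :=
  Submodule.span_le.2 (Set.range_subset_iff.2 (hx.mem n))

variable {A : Type*} [Ring A] [Algebra ℂ A]

/-- The algebra homomorphism out of `H` with prescribed values on the free generators. -/
noncomputable def lift (hx : IsHomogeneousFreeFamily 𝒜 x) (y : ∀ n, κ n → A) : H →ₐ[ℂ] A :=
  (FreeAlgebra.lift ℂ fun i : Σ n, κ n => y i.1 i.2).comp
    (AlgEquiv.ofBijective _ hx.bijective).symm.toAlgHom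

theorem lift_apply (hx : IsHomogeneousFreeFamily 𝒜 x) (y : ∀ n, κ n → A) (n : ℕ) (i : κ n) :
    hx.lift y (x n i) = y n i := by
  have : (AlgEquiv.ofBijective _ hx.bijective).symm (x n i) = FreeAlgebra.ι ℂ ⟨n, i⟩ := by
    rw [AlgEquiv.symm_apply_eq]
    simp
  simp [lift, this]

theorem algHom_ext (hx : IsHomogeneousFreeFamily 𝒜 x) {φ ψ : H →ₐ[ℂ] A}
    (h : ∀ n i, φ (x n i) = ψ (x n i)) : φ = ψ := by
  have : φ.comp (FreeAlgebra.lift ℂ fun i : Σ n, κ n => x i.1 i.2) =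
      ψ.comp (FreeAlgebra.lift ℂ fun i : Σ n, κ n => x i.1 i.2) := by
    ext i; simp [h]
  ext a
  obtain ⟨b, rfl⟩ := hx.bijective.2 a
  exact DFunLike.congr_fun this b

variable [GradedAlgebra 𝒜]

/-- `H = ℂ ⊕ E + D`, with `E` the span of the generators and `D` the decomposables: the right
side contains the generators and is closed under multiplication. -/
theorem one_sup_iSup_span_sup_decomposables
    (hx : IsHomogeneousFreeFamily 𝒜 x) :
    1 ⊔ ((⨆ n, Submodule.span ℂ (Set.range (x n))) ⊔ decomposables 𝒜) = ⊤ := by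
  set E := (⨆ n, Submodule.span ℂ (Set.range (x n))) ⊔ decomposables 𝒜 with hE
  have hmem : ∀ n i, x n i ∈ E := fun n i => Submodule.mem_sup_left
    (le_iSup (fun n => Submodule.span ℂ (Set.range (x n))) n
      (Submodule.subset_span (Set.mem_range_self i)))
  have hP : E ≤ positivePart 𝒜 := by
    refine sup_le (iSup_le fun n => Submodule.span_le.2 (Set.range_subset_iff.2 fun i => ?_)) ?_
    · have hn : 0 < n := by
        rcases Nat.eq_zero_or_pos n with rfl | hn
        · exact hx.isEmpty_zero.elim i
        · exact hn
      exact le_positivePart 𝒜 hn (hx.mem n i)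
    · simp only [decomposables, positivePart, Submodule.iSup_mul, Submodule.mul_iSup]
      refine iSup_le fun i => iSup_le fun j => Submodule.mul_le.2 fun a ha b hb => ?_
      exact le_positivePart 𝒜 (by omega) (SetLike.mul_mem_graded ha hb)
  have hEE : E * E ≤ E := (mul_le_mul' hP hP).trans le_sup_right
  rw [eq_top_iff]
  rintro a -
  obtain ⟨a, rfl⟩ := hx.bijective.2 a
  induction a using FreeAlgebra.induction with
  | grade0 r =>
    rw [AlgHom.commutes]
    exact Submodule.mem_sup_left (Submodule.algebraMap_mem r)
  | grade1 i =>
    rw [FreeAlgebra.lift_ι_apply]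
    exact Submodule.mem_sup_right (hmem _ _)
  | mul a b ha hb =>
    have : (1 ⊔ E) * (1 ⊔ E) ≤ 1 ⊔ E := by
      rw [Submodule.sup_mul, Submodule.mul_sup, one_mul, one_mul, Submodule.mul_sup, mul_one]
      exact sup_le le_rfl (sup_le le_sup_right (hEE.trans le_sup_right))
    rw [map_mul]
    exact this (Submodule.mul_mem_mul ha hb)
  | add a b ha hb => rw [map_add]; exact add_mem ha hb

theorem grade_zero_le_one (hx : IsHomogeneousFreeFamily 𝒜 x) : 𝒜 0 ≤ 1 := by
  intro a ha
  have hcomap : (⨆ n, Submodule.span ℂ (Set.range (x n))) ⊔ decomposables 𝒜 ≤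
      (⊥ : Submodule ℂ H).comap (GradedAlgebra.proj 𝒜 0) := by
    refine sup_le (iSup_le fun n => Submodule.span_le.2 (Set.range_subset_iff.2 fun i => ?_))
      fun d hd => ?_
    · have hn : n ≠ 0 := by rintro rfl; exact hx.isEmpty_zero.elim i
      simp [DirectSum.decompose_of_mem_ne 𝒜 (hx.mem n i) hn]
    · rw [Submodule.mem_comap, GradedAlgebra.proj_apply]
      refine decompose_mem_of_mem_decomposables ?_ hd
      intro i j hi hj hij
      omega
  obtain ⟨c, hc, e, he, rfl⟩ := Submodule.mem_sup.1
    (hx.one_sup_iSup_span_sup_decomposables.ge (Submodule.mem_top (x := a)))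
  have h0 : GradedAlgebra.proj 𝒜 0 e = 0 := hcomap he
  have hc0 : c ∈ 𝒜 0 := by
    obtain ⟨r, rfl⟩ := Submodule.mem_one.1 hc
    exact SetLike.algebraMap_mem_graded 𝒜 r
  have h1 := DirectSum.decompose_of_mem_same 𝒜 ha
  rw [← GradedAlgebra.proj_apply, map_add, h0, add_zero, GradedAlgebra.proj_apply,
    DirectSum.decompose_of_mem_same 𝒜 hc0] at h1
  rwa [← h1]

theorem le_span_sup_decomposables (hx : IsHomogeneousFreeFamily 𝒜 x) {n : ℕ} (hn : 0 < n) :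
    𝒜 n ≤ Submodule.span ℂ (Set.range (x n)) ⊔ decomposables 𝒜 := by
  intro a ha
  have hcomap : (⨆ n, Submodule.span ℂ (Set.range (x n))) ≤
      (Submodule.span ℂ (Set.range (x n))).comap (GradedAlgebra.proj 𝒜 n) := by
    refine iSup_le fun m => Submodule.span_le.2 (Set.range_subset_iff.2 fun i => ?_)
    rw [SetLike.mem_coe, Submodule.mem_comap, GradedAlgebra.proj_apply]
    by_cases h : m = n
    · subst h
      rw [DirectSum.decompose_of_mem_same 𝒜 (hx.mem m i)]
      exact Submodule.subset_span (Set.mem_range_self i)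
    · rw [DirectSum.decompose_of_mem_ne 𝒜 (hx.mem m i) h]
      exact zero_mem _
  obtain ⟨c, hc, y, hy, rfl⟩ := Submodule.mem_sup.1
    (hx.one_sup_iSup_span_sup_decomposables.ge (Submodule.mem_top (x := a)))
  obtain ⟨e, he, d, hd, rfl⟩ := Submodule.mem_sup.1 hy
  have hc0 : c ∈ 𝒜 0 := by
    obtain ⟨r, rfl⟩ := Submodule.mem_one.1 hc
    exact SetLike.algebraMap_mem_graded 𝒜 r
  have h1 := DirectSum.decompose_of_mem_same 𝒜 ha
  rw [← GradedAlgebra.proj_apply, map_add, map_add, GradedAlgebra.proj_apply,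
    DirectSum.decompose_of_mem_ne 𝒜 hc0 hn.ne, zero_add] at h1
  rw [← h1]
  refine Submodule.add_mem_sup (hcomap he) (decompose_mem_of_mem_decomposables ?_ hd)
  exact fun i j hi hj _ => mul_le_mul' (le_positivePart 𝒜 hi) (le_positivePart 𝒜 hj)

theorem finiteDimensional (hx : IsHomogeneousFreeFamily 𝒜 x) (n : ℕ) :
    FiniteDimensional ℂ (𝒜 n) := by
  induction n using Nat.strong_induction_on with
  | _ n ih =>
    rcases Nat.eq_zero_or_pos n with rfl | hn
    · have : FiniteDimensional ℂ (1 : Submodule ℂ H) := by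
        rw [Submodule.one_eq_span]; infer_instance
      exact Submodule.finiteDimensional_of_le hx.grade_zero_le_one
    · let s := (Finset.HasAntidiagonal.antidiagonal n).filter fun p => 0 < p.1 ∧ 0 < p.2
      have hM : (⨆ p ∈ s, 𝒜 p.1 * 𝒜 p.2).FG := by
        refine Submodule.fg_biSup s _ fun p hp => ?_
        simp only [s, Finset.mem_filter, Finset.HasAntidiagonal.mem_antidiagonal] at hp
        exact (Submodule.fg_iff_finiteDimensional _ |>.2 (ih _ (by omega))).mul
          (Submodule.fg_iff_finiteDimensional _ |>.2 (ih _ (by omega)))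
      have := hx.finite n
      have hfg := (Submodule.fg_span (R := ℂ) (Set.finite_range (x n))).sup hM
      have := (Submodule.fg_iff_finiteDimensional _).1 hfg
      refine Submodule.finiteDimensional_of_le (S₂ := _ ⊔ ⨆ p ∈ s, 𝒜 p.1 * 𝒜 p.2)
        (le_sup_of_le_sup_decomposables (hx.span_le n)
          (hx.le_span_sup_decomposables hn) fun i j hi hj hij => ?_)
      exact le_iSup₂_of_le (i, j) (by simp [s, hi, hj, hij]) le_rfl

/-- Induction on the degree: a family of subspaces that contains the unit and the generators and
is compatible with products contains the components of `H`. -/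
theorem le_of_mul_le (hx : IsHomogeneousFreeFamily 𝒜 x) {M : ℕ → Submodule ℂ H} (h1 : 1 ≤ M 0)
    (hM : ∀ n i, x n i ∈ M n) (hmul : ∀ i j, 0 < i → 0 < j → 𝒜 i ≤ M i → 𝒜 j ≤ M j →
      𝒜 i * 𝒜 j ≤ M (i + j)) (n : ℕ) : 𝒜 n ≤ M n := by
  induction n using Nat.strong_induction_on with
  | _ n ih =>
    rcases Nat.eq_zero_or_pos n with rfl | hn
    · exact hx.grade_zero_le_one.trans h1
    · refine (le_sup_of_le_sup_decomposables (M := M n) (hx.span_le n)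
        (hx.le_span_sup_decomposables hn) ?_).trans
        (sup_le (Submodule.span_le.2 (Set.range_subset_iff.2 (hM n))) le_rfl)
      rintro i j hi hj rfl
      exact hmul i j hi hj (ih i (by omega)) (ih j (by omega))

theorem isGradedMap (hx : IsHomogeneousFreeFamily 𝒜 x) {ℬ : ℕ → Submodule ℂ A} [GradedAlgebra ℬ]
    {θ : H →ₐ[ℂ] A} (h : ∀ n i, θ (x n i) ∈ ℬ n) : IsGradedMap 𝒜 ℬ θ := by
  refine hx.le_of_mul_le (M := fun n => (ℬ n).comap θ.toLinearMap) ?_ h ?_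
  · rw [Submodule.one_le]
    simpa using SetLike.one_mem_graded ℬ
  · intro i j _ _ hi hj
    refine Submodule.mul_le.2 fun a ha b hb => ?_
    have ha' : θ a ∈ ℬ i := hi ha
    have hb' : θ b ∈ ℬ j := hj hb
    simpa using SetLike.mul_mem_graded ha' hb'

/-- The generators are linearly independent modulo decomposables: the homomorphism from `H` to a
square-zero extension of `ℂ` that sends the generators to a basis of the ideal kills the
decomposables. -/
theorem linearIndependent (hx : IsHomogeneousFreeFamily 𝒜 x) (n : ℕ) :
    LinearIndependent ℂ fun i => (decomposables 𝒜).mkQ (x n i) := by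
  classical
  let Φ : H →ₐ[ℂ] TrivSqZeroExt ℂ ((Σ n, κ n) →₀ ℂ) :=
    hx.lift fun n i => TrivSqZeroExt.inr (Finsupp.single ⟨n, i⟩ 1)
  have hΦ : ∀ n i, Φ (x n i) = TrivSqZeroExt.inr (Finsupp.single ⟨n, i⟩ 1) := hx.lift_apply _
  have hfst : ∀ n, 0 < n → ∀ a ∈ 𝒜 n, (Φ a).fst = 0 := by
    have := hx.le_of_mul_le (M := fun n => if n = 0 then ⊤ else
      LinearMap.ker ((TrivSqZeroExt.fstHom ℂ ℂ ((Σ n, κ n) →₀ ℂ)).comp Φ).toLinearMap)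
      (by simp) (fun n i => by split_ifs <;> simp [hΦ]) (fun i j hi hj h1 h2 => by
        rw [if_neg (by omega)] at h1 h2 ⊢
        refine Submodule.mul_le.2 fun a ha b hb => ?_
        have := h1 ha
        simp at this
        simp [this])
    intro n hn a ha
    have := this n ha
    simpa [hn.ne'] using this
  have hP : ∀ a ∈ positivePart 𝒜, (Φ a).fst = 0 := by
    have : positivePart 𝒜 ≤
        LinearMap.ker ((TrivSqZeroExt.fstHom ℂ ℂ ((Σ n, κ n) →₀ ℂ)).comp Φ).toLinearMap :=
      iSup_le fun n a ha => hfst _ n.succ_pos a ha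
    exact fun a ha => this ha
  let L : H →ₗ[ℂ] ((Σ n, κ n) →₀ ℂ) := TrivSqZeroExt.sndHom ℂ _ ∘ₗ Φ.toLinearMap
  have hL : decomposables 𝒜 ≤ LinearMap.ker L := by
    refine Submodule.mul_le.2 fun a ha b hb => ?_
    simp [L, hP a ha, hP b hb]
  refine LinearIndependent.of_comp ((decomposables 𝒜).liftQ L hL) ?_
  have : ⇑((decomposables 𝒜).liftQ L hL) ∘ (fun i => (decomposables 𝒜).mkQ (x n i)) =
      (fun j => Finsupp.single j (1 : ℂ)) ∘ Sigma.mk n := by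
    ext1 i
    simp [L, hΦ]
  rw [this]
  exact (Finsupp.linearIndependent_single_one ℂ _).comp _ sigma_mk_injective

theorem span_mkQ (hx : IsHomogeneousFreeFamily 𝒜 x) {n : ℕ} (hn : 0 < n) :
    Submodule.span ℂ (Set.range fun i => (decomposables 𝒜).mkQ (x n i)) =
      (𝒜 n).map (decomposables 𝒜).mkQ := by
  have : (Set.range fun i => (decomposables 𝒜).mkQ (x n i)) =
      (decomposables 𝒜).mkQ '' Set.range (x n) := by
    rw [← Set.range_comp]; rfl
  rw [this, Submodule.span_image]
  refine le_antisymm (Submodule.map_mono (hx.span_le n)) ?_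
  refine (Submodule.map_mono (hx.le_span_sup_decomposables hn)).trans ?_
  rw [Submodule.map_sup, sup_le_iff]
  refine ⟨le_rfl, ?_⟩
  rw [Submodule.map_le_iff_le_comap]
  intro d hd
  have : (decomposables 𝒜).mkQ d = 0 := by simpa using hd
  simp only [Submodule.mem_comap, this, zero_mem]

/-- Homogeneous elements whose classes form bases of the spaces of indecomposables are again free
generators. They can be matched with the given generators by degree, and the resulting graded
endomorphism is surjective, hence bijective as the components are finite-dimensional. -/
theorem of_linearIndependent (hx : IsHomogeneousFreeFamily 𝒜 x) {κ' : ℕ → Type*}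
    {x' : ∀ n, κ' n → H} (hempty : IsEmpty (κ' 0)) (hfin : ∀ n, Finite (κ' n))
    (hmem : ∀ n i, x' n i ∈ 𝒜 n)
    (hli : ∀ n, 0 < n → LinearIndependent ℂ fun i => (decomposables 𝒜).mkQ (x' n i))
    (hspan : ∀ n, 0 < n →
      Submodule.span ℂ (Set.range fun i => (decomposables 𝒜).mkQ (x' n i)) =
        (𝒜 n).map (decomposables 𝒜).mkQ) :
    IsHomogeneousFreeFamily 𝒜 x' := by
  have hcard : ∀ n, Nonempty (κ n ≃ κ' n) := fun n => by
    rcases Nat.eq_zero_or_pos n with rfl | hn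
    · have := hx.isEmpty_zero
      exact ⟨Equiv.equivOfIsEmpty _ _⟩
    · have := hx.finite n
      have := hfin n
      have := Fintype.ofFinite (κ n)
      have := Fintype.ofFinite (κ' n)
      refine Fintype.card_eq.1 ?_
      rw [← finrank_span_eq_card (hx.linearIndependent n), ← finrank_span_eq_card (hli n hn),
        hspan n hn, hx.span_mkQ hn]
  let σ := fun n => (hcard n).some
  let θ : H →ₐ[ℂ] H := hx.lift fun n i => x' n (σ n i)
  have hθ : ∀ n i, θ (x n i) = x' n (σ n i) := hx.lift_apply _
  have hgr : IsGradedMap 𝒜 𝒜 θ := hx.isGradedMap fun n i => by rw [hθ]; exact hmem _ _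
  -- Degree by degree, the image contains the new generators and all products of lower degree.
  have hrange : ∀ n, 𝒜 n ≤ Subalgebra.toSubmodule θ.range := by
    intro n
    induction n using Nat.strong_induction_on with
    | _ n ih =>
      rcases Nat.eq_zero_or_pos n with rfl | hn
      · refine hx.grade_zero_le_one.trans (Submodule.one_le.2 ?_)
        exact one_mem θ.range
      · have hE : Submodule.span ℂ (Set.range (x' n)) ≤ 𝒜 n :=
          Submodule.span_le.2 (Set.range_subset_iff.2 (hmem n))
        have hsup : 𝒜 n ≤ Submodule.span ℂ (Set.range (x' n)) ⊔ decomposables 𝒜 := by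
          rw [← (decomposables 𝒜).ker_mkQ, ← Submodule.comap_map_eq,
            ← Submodule.map_le_iff_le_comap, ← hspan n hn, Submodule.map_span, ← Set.range_comp]
          rfl
        refine (le_sup_of_le_sup_decomposables hE hsup
          (M := Subalgebra.toSubmodule θ.range) ?_).trans (sup_le ?_ le_rfl)
        · intro i j hi hj hij
          exact Submodule.mul_le.2 fun a ha b hb =>
            mul_mem (S := Subalgebra ℂ H) (s := θ.range) (ih i (by omega) ha) (ih j (by omega) hb)
        · refine Submodule.span_le.2 (Set.range_subset_iff.2 fun i => ?_)
          exact ⟨x n ((σ n).symm i), by simp [hθ]⟩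
  have hsurj : Function.Surjective θ := fun a => by
    have : a ∈ Subalgebra.toSubmodule θ.range := by
      induction a using DirectSum.Decomposition.inductionOn 𝒜 with
      | zero => exact zero_mem _
      | add a b ha hb => exact add_mem ha hb
      | homogeneous a => exact hrange _ a.2
    exact this
  have hbij : Function.Bijective θ := ⟨IsGradedMap.injective_of_surjective (θ := θ.toLinearMap) hgr
    hx.finiteDimensional hsurj, hsurj⟩
  refine ⟨hempty, hfin, hmem, ?_, ?_⟩
  · let ρ := (hx.lift fun n i => FreeAlgebra.ι ℂ (X := Σ n, κ' n) ⟨n, σ n i⟩).comp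
      (AlgEquiv.ofBijective θ hbij).symm.toAlgHom
    have hρ : ρ.comp (FreeAlgebra.lift ℂ fun i : Σ n, κ' n => x' i.1 i.2) = AlgHom.id ℂ _ := by
      ext ⟨n, i⟩
      have : (AlgEquiv.ofBijective θ hbij).symm (x' n i) = x n ((σ n).symm i) := by
        rw [AlgEquiv.symm_apply_eq]
        simp [hθ]
      simp [ρ, this, hx.lift_apply]
    exact Function.LeftInverse.injective (g := ρ) fun a => DFunLike.congr_fun hρ a
  · have : θ = (FreeAlgebra.lift ℂ fun i : Σ n, κ' n => x' i.1 i.2).comp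
        (hx.lift fun n i => FreeAlgebra.ι ℂ ⟨n, σ n i⟩) :=
      hx.algHom_ext fun n i => by simp [hθ, hx.lift_apply]
    rw [this, AlgHom.coe_comp] at hsurj
    exact hsurj.of_comp

end IsHomogeneousFreeFamily

end FreeGenerators

/-! ### Primitive elements modulo decomposables -/

section PrimitiveModDecomposables

variable {H : Type*} [Ring H] [HopfAlgebra ℂ H] {𝒜 : ℕ → Submodule ℂ H} [GradedAlgebra 𝒜]

theorem degreeMap_mem_positivePart (a : H) : degreeMap 𝒜 a ∈ positivePart 𝒜 := by
  induction a using DirectSum.Decomposition.inductionOn 𝒜 with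
  | zero => simp
  | add a b ha hb => rw [map_add]; exact add_mem ha hb
  | homogeneous a =>
    rename_i n
    rw [degreeMap_of_mem 𝒜 a.2]
    rcases Nat.eq_zero_or_pos n with rfl | hn
    · simp
    · exact Submodule.smul_mem _ _ (le_positivePart 𝒜 hn a.2)

theorem sub_counit_mem_positivePart (h : IsGradedHopfAlgebra 𝒜) (h0 : 𝒜 0 ≤ 1) (a : H) :
    a - algebraMap ℂ H (CoalgebraStruct.counit (R := ℂ) a) ∈ positivePart 𝒜 := by
  induction a using DirectSum.Decomposition.inductionOn 𝒜 with
  | zero => simp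
  | add a b ha hb =>
    rw [map_add, map_add, add_sub_add_comm]
    exact add_mem ha hb
  | homogeneous a =>
    rename_i n
    rcases Nat.eq_zero_or_pos n with rfl | hn
    · obtain ⟨r, hr⟩ := Submodule.mem_one.1 (h0 a.2)
      rw [← hr, Bialgebra.counit_algebraMap, sub_self]
      exact zero_mem _
    · rw [h.counit_eq_zero n hn.ne' a a.2, map_zero, sub_zero]
      exact le_positivePart 𝒜 hn a.2

/-- Modulo decomposables, the Dynkin operator is the degree operator: `S(a') * Y(a'')` is congruent
to `ε(S(a')) Y(a'')`, since `Y` takes values in positive degrees. -/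
theorem mkQ_dynkin (h : IsGradedHopfAlgebra 𝒜) (h0 : 𝒜 0 ≤ 1) (a : H) :
    (decomposables 𝒜).mkQ (dynkin 𝒜 a) = (decomposables 𝒜).mkQ (degreeMap 𝒜 a) := by
  have key : (decomposables 𝒜).mkQ ∘ₗ LinearMap.mul' ℂ H ∘ₗ
      TensorProduct.map (HopfAlgebraStruct.antipode ℂ) (degreeMap 𝒜) =
      (decomposables 𝒜).mkQ ∘ₗ degreeMap 𝒜 ∘ₗ (TensorProduct.lid ℂ H).toLinearMap ∘ₗ
        (CoalgebraStruct.counit (R := ℂ) (A := H)).rTensor H := by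
    ext u v
    have h1 := sub_counit_mem_positivePart h h0 (HopfAlgebraStruct.antipode ℂ u)
    rw [HopfAlgebra.counit_antipode] at h1
    have h2 := Submodule.mul_mem_mul h1 (degreeMap_mem_positivePart (𝒜 := 𝒜) v)
    rw [sub_mul, ← Algebra.smul_def] at h2
    simpa using (Submodule.Quotient.eq (decomposables 𝒜)).2 h2
  have := LinearMap.congr_fun key (CoalgebraStruct.comul (R := ℂ) a)
  simpa [dynkin] using this

/-- A homogeneous element `a` of positive degree `n` is congruent to the primitive element
`n⁻¹ • D a`, with `D` the Dynkin operator. -/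
theorem exists_primitive_mkQ_eq (h : IsGradedHopfAlgebra 𝒜) (hc : Coalgebra.IsCocomm ℂ H)
    (h0 : 𝒜 0 ≤ 1) {n : ℕ} (hn : 0 < n) {a : H} (ha : a ∈ 𝒜 n) :
    ∃ b ∈ primitives ℂ H ⊓ 𝒜 n, (decomposables 𝒜).mkQ b = (decomposables 𝒜).mkQ a := by
  refine ⟨(n : ℂ)⁻¹ • dynkin 𝒜 a, ⟨Submodule.smul_mem _ _ (dynkin_mem_primitives h hc a),
    Submodule.smul_mem _ _ (dynkin_mem h ha)⟩, ?_⟩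
  have hn' : (n : ℂ) ≠ 0 := Nat.cast_ne_zero.2 hn.ne'
  rw [map_smul, mkQ_dynkin h h0, degreeMap_of_mem 𝒜 ha, map_smul, inv_smul_smul₀ hn']

end PrimitiveModDecomposables

/-! ### Bialgebra homomorphisms on primitive generators -/

section BialgHom

variable {H K : Type*} [Ring H] [HopfAlgebra ℂ H] [Ring K] [HopfAlgebra ℂ K]
  {𝒜 : ℕ → Submodule ℂ H}

/-- An algebra homomorphism sending primitive free generators to primitive elements is a bialgebra
homomorphism. -/
noncomputable def IsHomogeneousFreeFamily.liftBialgHom {κ : ℕ → Type*} {x : ∀ n, κ n → H}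
    (hx : IsHomogeneousFreeFamily 𝒜 x) (hxp : ∀ n i, x n i ∈ primitives ℂ H)
    {y : ∀ n, κ n → K} (hyp : ∀ n i, y n i ∈ primitives ℂ K) : H →ₐc[ℂ] K :=
  BialgHom.ofAlgHom (hx.lift y)
    (hx.algHom_ext fun n i => by
      simp [hx.lift_apply, counit_eq_zero_of_mem_primitives (hxp n i),
        counit_eq_zero_of_mem_primitives (hyp n i)])
    (hx.algHom_ext fun n i => by
      simp [hx.lift_apply, mem_primitives.1 (hxp n i), mem_primitives.1 (hyp n i)])

theorem IsHomogeneousFreeFamily.liftBialgHom_apply {κ : ℕ → Type*} {x : ∀ n, κ n → H}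
    (hx : IsHomogeneousFreeFamily 𝒜 x) (hxp : ∀ n i, x n i ∈ primitives ℂ H)
    {y : ∀ n, κ n → K} (hyp : ∀ n i, y n i ∈ primitives ℂ K) (n : ℕ) (i : κ n) :
    hx.liftBialgHom hxp hyp (x n i) = y n i := hx.lift_apply y n i

theorem IsHomogeneousFreeFamily.bialgHom_ext {κ : ℕ → Type*} {x : ∀ n, κ n → H}
    (hx : IsHomogeneousFreeFamily 𝒜 x) {φ ψ : H →ₐc[ℂ] K} (h : ∀ n i, φ (x n i) = ψ (x n i)) :
    φ = ψ := by
  have := hx.algHom_ext (φ := (φ : H →ₐ[ℂ] K)) (ψ := (ψ : H →ₐ[ℂ] K)) h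
  ext a
  exact DFunLike.congr_fun this a

/-- Two families of primitive free generators with the same index types are exchanged by a graded
bialgebra automorphism. -/
theorem IsHomogeneousFreeFamily.exists_bialgEquiv [GradedAlgebra 𝒜] {κ : ℕ → Type*}
    {x y : ∀ n, κ n → H} (hx : IsHomogeneousFreeFamily 𝒜 x)
    (hxp : ∀ n i, x n i ∈ primitives ℂ H) (hy : IsHomogeneousFreeFamily 𝒜 y)
    (hyp : ∀ n i, y n i ∈ primitives ℂ H) :
    ∃ e : H ≃ₐc[ℂ] H, (∀ n i, e (x n i) = y n i) ∧ IsGradedMap 𝒜 𝒜 e ∧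
      IsGradedMap 𝒜 𝒜 e.symm := by
  let φ := hx.liftBialgHom hxp hyp
  let ψ := hy.liftBialgHom hyp hxp
  have hφ : ∀ n i, φ (x n i) = y n i := hx.liftBialgHom_apply hxp hyp
  have hψ : ∀ n i, ψ (y n i) = x n i := hy.liftBialgHom_apply hyp hxp
  have h1 : ψ.comp φ = BialgHom.id ℂ H := hx.bialgHom_ext fun n i => by simp [hφ, hψ]
  have h2 : φ.comp ψ = BialgHom.id ℂ H := hy.bialgHom_ext fun n i => by simp [hφ, hψ]
  have hbij : Function.Bijective φ := Function.bijective_iff_has_inverse.2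
    ⟨ψ, fun a => DFunLike.congr_fun h1 a, fun a => DFunLike.congr_fun h2 a⟩
  have hgr : IsGradedMap 𝒜 𝒜 φ := hx.isGradedMap (θ := (φ : H →ₐ[ℂ] H)) fun n i => by
    have := hy.mem n i
    rwa [← hφ] at this
  refine ⟨BialgEquiv.ofBijective φ hbij, hφ, hgr, fun n a ha => ?_⟩
  refine IsGradedMap.mem_of_map_mem (θ := (φ : H →ₐ[ℂ] H).toLinearMap) hgr hbij.1 ?_
  have : φ ((BialgEquiv.ofBijective φ hbij).symm a) = a :=
    (BialgEquiv.ofBijective φ hbij).apply_symm_apply a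
  exact this.symm ▸ ha

end BialgHom

/-! ### The image of a homomorphism of Hopf algebras -/

section Range

variable {k : Type u} {H : Type v} {K : Type*} [Field k] [Ring H] [HopfAlgebra k H] [Ring K]
  [HopfAlgebra k K]

open WithConv in
/-- Bialgebra homomorphisms between Hopf algebras commute with the antipodes, as both composites
are convolution inverses of the homomorphism. -/
theorem BialgHom.map_antipode_apply (s : K →ₐc[k] H) (a : K) :
    s (HopfAlgebraStruct.antipode k a) = HopfAlgebraStruct.antipode k (s a) := by
  let t : K →ₐ[k] H := s
  have h1 : toConv (t.toLinearMap ∘ₗ HopfAlgebraStruct.antipode k) * toConv t.toLinearMap = 1 := by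
    have := LinearMap.algHom_comp_convMul_distrib t
      (toConv (HopfAlgebraStruct.antipode k (A := K))) (toConv LinearMap.id)
    rw [LinearMap.antipode_mul_id] at this
    rw [show toConv t.toLinearMap = toConv (t.toLinearMap ∘ₗ LinearMap.id) from rfl]
    refine (congrArg toConv this).symm.trans ?_
    ext y
    simp [LinearMap.convOne_def]
  have h2 : toConv t.toLinearMap * toConv (HopfAlgebraStruct.antipode k ∘ₗ t.toLinearMap) = 1 := by
    have := LinearMap.convMul_comp_coalgHom_distrib (toConv LinearMap.id)
      (toConv (HopfAlgebraStruct.antipode k (A := H))) (s : K →ₗc[k] H)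
    rw [LinearMap.id_mul_antipode] at this
    refine (congrArg toConv this).symm.trans ?_
    ext y
    simp [LinearMap.convOne_def]
  exact LinearMap.congr_fun (congrArg ofConv (left_inv_eq_right_inv h1 h2)) a

/-- The image of a bialgebra homomorphism between Hopf algebras, as a Hopf subalgebra. -/
noncomputable def BialgHom.hopfRange (s : K →ₐc[k] H) : HopfSubalgebra k H where
  toSubalgebra := (s : K →ₐ[k] H).range
  comul_mem' := by
    rintro _ ⟨a, rfl⟩
    let r : K →ₗ[k] Subalgebra.toSubmodule (s : K →ₐ[k] H).range :=
      (s : K →ₐ[k] H).rangeRestrict.toLinearMap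
    refine ⟨TensorProduct.map r r (CoalgebraStruct.comul (R := k) a), ?_⟩
    rw [tensorIncl, ← LinearMap.comp_apply, ← TensorProduct.map_comp]
    exact CoalgHomClass.map_comp_comul_apply s a
  antipode_mem' := by
    rintro _ ⟨a, rfl⟩
    exact ⟨_, s.map_antipode_apply a⟩

/-- The corestriction of a bialgebra homomorphism to its image. -/
noncomputable def BialgHom.hopfRangeRestrict (s : K →ₐc[k] H) :
    K →ₐc[k] s.hopfRange.toSubalgebra :=
  BialgHom.ofAlgHom (s : K →ₐ[k] H).rangeRestrict
    (by
      ext a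
      exact CoalgHomClass.counit_comp_apply s a)
    (by
      ext a
      apply s.hopfRange.map_incl_injective
      refine Eq.trans ?_ (s.hopfRange.map_incl_comul _).symm
      refine Eq.trans ?_ (CoalgHomClass.map_comp_comul_apply s a)
      have : TensorProduct.map s.hopfRange.incl s.hopfRange.incl ∘ₗ
          (Algebra.TensorProduct.map (s : K →ₐ[k] H).rangeRestrict
            (s : K →ₐ[k] H).rangeRestrict).toLinearMap =
          TensorProduct.map (s : K →ₗ[k] H) (s : K →ₗ[k] H) := by
        ext a b; rfl
      exact LinearMap.congr_fun this _)

theorem BialgHom.hopfRangeRestrict_surjective (s : K →ₐc[k] H) :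
    Function.Surjective s.hopfRangeRestrict :=
  (s : K →ₐ[k] H).rangeRestrict_surjective

end Range

/-! ### Generators adapted to a surjective homomorphism -/

section Adapted

/-- The space of indecomposables of degree `n`, set to `0` for `n = 0`. -/
def indecomposables {H : Type*} [Ring H] [Algebra ℂ H] (𝒜 : ℕ → Submodule ℂ H) (n : ℕ) :
    Submodule ℂ (H ⧸ decomposables 𝒜) :=
  if n = 0 then ⊥ else (𝒜 n).map (decomposables 𝒜).mkQ

theorem indecomposables_zero {H : Type*} [Ring H] [Algebra ℂ H] (𝒜 : ℕ → Submodule ℂ H) :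
    indecomposables 𝒜 0 = ⊥ := if_pos rfl

theorem indecomposables_of_pos {H : Type*} [Ring H] [Algebra ℂ H] (𝒜 : ℕ → Submodule ℂ H) {n : ℕ}
    (hn : 0 < n) : indecomposables 𝒜 n = (𝒜 n).map (decomposables 𝒜).mkQ := if_neg hn.ne'

theorem IsFGCCHA.finiteDimensional_indecomposables {H : Type*} [Ring H] [HopfAlgebra ℂ H]
    {𝒜 : ℕ → Submodule ℂ H} [GradedAlgebra 𝒜] (hH : IsFGCCHA H 𝒜) (n : ℕ) :
    FiniteDimensional ℂ (indecomposables 𝒜 n) := by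
  obtain ⟨X, hX⟩ := hH.free
  have := hX.isHomogeneousFreeFamily.finiteDimensional n
  rcases Nat.eq_zero_or_pos n with rfl | hn
  · rw [indecomposables_zero]; infer_instance
  · rw [indecomposables_of_pos 𝒜 hn]; infer_instance

/-- If `f` maps primitive homogeneous elements to free generators of `K`, it has a graded section
that is a bialgebra homomorphism. -/
theorem exists_graded_section {H K : Type*} [Ring H] [HopfAlgebra ℂ H] {𝒜 : ℕ → Submodule ℂ H}
    [GradedAlgebra 𝒜] [Ring K] [HopfAlgebra ℂ K] {ℬ : ℕ → Submodule ℂ K} [GradedAlgebra ℬ]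
    (f : H →ₐc[ℂ] K) {κ : ℕ → Type*} {u : ∀ n, κ n → H}
    (hy : IsHomogeneousFreeFamily ℬ (fun n i => f (u n i)))
    (hup : ∀ n i, u n i ∈ primitives ℂ H) (hu : ∀ n i, u n i ∈ 𝒜 n) :
    ∃ s : K →ₐc[ℂ] H, (∀ n i, s (f (u n i)) = u n i) ∧ (∀ b, f (s b) = b) ∧
      IsGradedMap ℬ 𝒜 s := by
  let s := hy.liftBialgHom (fun n i => map_mem_primitives f (hup n i)) hup
  have hs : ∀ n i, s (f (u n i)) = u n i := hy.liftBialgHom_apply _ _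
  have hfs : f.comp s = BialgHom.id ℂ K := hy.bialgHom_ext fun n i => by simp [hs]
  refine ⟨s, hs, fun b => DFunLike.congr_fun hfs b, ?_⟩
  refine hy.isGradedMap (θ := (s : K →ₐ[ℂ] H)) fun n i => ?_
  have := hu n i
  rwa [← hs n i] at this

/-- A surjective homomorphism `f : H → K` is, up to the choice of primitive free generators, the
projection that keeps the generators `u` and kills the generators `z`. The numbers of generators
of each kind in each degree depend on `H` and `K` only. -/
theorem exists_adapted_generators {H K : Type*} [Ring H] [HopfAlgebra ℂ H]
    (𝒜 : ℕ → Submodule ℂ H) [GradedAlgebra 𝒜] [Ring K] [HopfAlgebra ℂ K]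
    (ℬ : ℕ → Submodule ℂ K) [GradedAlgebra ℬ] (hH : IsFGCCHA H 𝒜) (hK : IsFGCCHA K ℬ) :
    ∃ r m : ℕ → ℕ, ∀ f : H →ₐc[ℂ] K, IsGradedMap 𝒜 ℬ f → Function.Surjective f →
      ∃ (u : ∀ n, Fin (r n) → H) (z : ∀ n, Fin (m n) → H),
        (∀ n i, u n i ∈ primitives ℂ H) ∧ (∀ n i, z n i ∈ primitives ℂ H) ∧
        (∀ n i, f (z n i) = 0) ∧
        IsHomogeneousFreeFamily 𝒜 (fun n => Sum.elim (u n) (z n)) ∧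
        IsHomogeneousFreeFamily ℬ (fun n i => f (u n i)) := by
  have hfinH := hH.finiteDimensional_indecomposables
  have hfinK := hK.finiteDimensional_indecomposables
  obtain ⟨X, hX⟩ := hH.free
  obtain ⟨Y, hY⟩ := hK.free
  have hX := hX.isHomogeneousFreeFamily
  have hY := hY.isHomogeneousFreeFamily
  let r n := Module.finrank ℂ (indecomposables ℬ n)
  refine ⟨r, fun n => Module.finrank ℂ (indecomposables 𝒜 n) - r n, fun f hf hfs => ?_⟩
  let f' : H →ₐ[ℂ] K := f
  have hDf := IsGradedMap.map_decomposables_le (θ := f') hf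
  let Qf := (decomposables 𝒜).mapQ (decomposables ℬ) f'.toLinearMap
    (Submodule.map_le_iff_le_comap.1 hDf)
  have hQf : ∀ a, Qf ((decomposables 𝒜).mkQ a) = (decomposables ℬ).mkQ (f a) := fun a => rfl
  have hprim : ∀ n, 0 < n → ∀ a ∈ 𝒜 n, ∃ b ∈ primitives ℂ H ⊓ 𝒜 n,
      (decomposables 𝒜).mkQ b = (decomposables 𝒜).mkQ a := fun n hn a ha =>
    exists_primitive_mkQ_eq hH.graded hH.cocomm hX.grade_zero_le_one hn ha
  -- Primitive lifts of bases of the indecomposables of `K`.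
  have hu : ∀ n, ∀ i, ∃ a ∈ primitives ℂ H ⊓ 𝒜 n, (decomposables ℬ).mkQ (f a) =
      (Module.finBasis ℂ (indecomposables ℬ n) i : K ⧸ decomposables ℬ) := by
    intro n i
    have hi := (Module.finBasis ℂ (indecomposables ℬ n) i).2
    set b := (Module.finBasis ℂ (indecomposables ℬ n) i : K ⧸ decomposables ℬ)
    rw [indecomposables] at hi
    split_ifs at hi with hn
    · refine ⟨0, zero_mem _, ?_⟩
      rw [(Submodule.mem_bot ℂ).1 hi, map_zero, map_zero]
    · obtain ⟨c, hc, hcb⟩ := hi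
      obtain ⟨a, ha, rfl⟩ := IsGradedMap.exists_of_surjective (θ := f'.toLinearMap) hf hfs hc
      obtain ⟨a', ha', haa'⟩ := hprim n (Nat.pos_of_ne_zero hn) a ha
      refine ⟨a', ha', ?_⟩
      rw [← hQf, haa', ← hcb]
      rfl
  choose u hu hub using hu
  have hub' : ∀ n, (fun i => (decomposables ℬ).mkQ (f (u n i))) =
      (indecomposables ℬ n).subtype ∘ Module.finBasis ℂ (indecomposables ℬ n) := fun n =>
    funext fun i => hub n i
  have huli : ∀ n, LinearIndependent ℂ fun i => (decomposables ℬ).mkQ (f (u n i)) := fun n => by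
    rw [hub']
    exact (Module.finBasis ℂ (indecomposables ℬ n)).linearIndependent.map'
      _ (Submodule.ker_subtype _)
  have huspan : ∀ n, Submodule.span ℂ (Set.range fun i => (decomposables ℬ).mkQ (f (u n i))) =
      indecomposables ℬ n := fun n => by
    rw [hub', Set.range_comp, Submodule.span_image, Module.Basis.span_eq, Submodule.map_top,
      Submodule.range_subtype]
  -- Degree 0 has been set to `⊥` in `indecomposables`, so it contributes no generators.
  have hr0 : r 0 = 0 := by
    change Module.finrank ℂ (indecomposables ℬ 0) = 0
    rw [indecomposables_zero, finrank_bot]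
  have hempty : IsEmpty (Fin (r 0)) := by rw [hr0]; infer_instance
  have hy : IsHomogeneousFreeFamily ℬ (fun n i => f (u n i)) :=
    hY.of_linearIndependent hempty (fun n => inferInstance) (fun n i => hf n _ (hu n i).2)
      (fun n _ => huli n) fun n hn => by rw [huspan, indecomposables_of_pos _ hn]
  obtain ⟨s, hs, hfs, hsgr⟩ := exists_graded_section f hy (fun n i => (hu n i).1)
    fun n i => (hu n i).2
  let s' : K →ₐ[ℂ] H := s
  let Qs := (decomposables ℬ).mapQ (decomposables 𝒜) s'.toLinearMap
    (Submodule.map_le_iff_le_comap.1 (IsGradedMap.map_decomposables_le (θ := s') hsgr))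
  have hQs : ∀ b, Qs ((decomposables ℬ).mkQ b) = (decomposables 𝒜).mkQ (s b) := fun b => rfl
  -- The classes of primitive elements of `ker f` complement the span of the classes of `u`.
  let U n := Submodule.span ℂ (Set.range fun i => (decomposables 𝒜).mkQ (u n i))
  let N n : Submodule ℂ (H ⧸ decomposables 𝒜) := if n = 0 then ⊥ else
    (primitives ℂ H ⊓ 𝒜 n ⊓ LinearMap.ker f'.toLinearMap).map (decomposables 𝒜).mkQ
  have huli' : ∀ n, LinearIndependent ℂ fun i => (decomposables 𝒜).mkQ (u n i) := fun n =>
    LinearIndependent.of_comp Qf (huli n)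
  have hdisj : ∀ n, Disjoint (U n) (N n) := fun n => by
    have h1 : Disjoint (U n) (LinearMap.ker Qf) := Submodule.range_ker_disjoint (huli n)
    refine h1.mono_right ?_
    simp only [N]
    split_ifs
    · exact bot_le
    · rw [Submodule.map_le_iff_le_comap]
      rintro a ⟨-, ha⟩
      rw [Submodule.mem_comap, LinearMap.mem_ker, hQf]
      have : f a = 0 := ha
      rw [this, map_zero]
  have hsup : ∀ n, U n ⊔ N n = indecomposables 𝒜 n := by
    intro n
    rcases Nat.eq_zero_or_pos n with rfl | hn
    · have hU : U 0 = ⊥ := by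
        rw [← Submodule.span_empty]
        exact congrArg (Submodule.span ℂ) (Set.range_eq_empty_iff.2 hempty)
      have hN : N 0 = ⊥ := if_pos rfl
      rw [hU, hN, indecomposables_zero, bot_sup_eq]
    · simp only [N, indecomposables_of_pos _ hn, if_neg hn.ne']
      apply le_antisymm
      · refine sup_le (Submodule.span_le.2 (Set.range_subset_iff.2 fun i => ?_)) ?_
        · exact Submodule.mem_map_of_mem (hu n i).2
        · exact Submodule.map_mono (inf_le_left.trans inf_le_right)
      · rintro _ ⟨a, ha, rfl⟩
        obtain ⟨b, ⟨hbp, hb⟩, hab⟩ := hprim n hn a ha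
        rw [← hab, ← add_sub_cancel (s (f b)) b, map_add]
        refine Submodule.add_mem_sup ?_ (Submodule.mem_map_of_mem ⟨⟨?_, ?_⟩, ?_⟩)
        · have h1 : (decomposables ℬ).mkQ (f b) ∈ indecomposables ℬ n := by
            rw [indecomposables_of_pos _ hn]
            exact Submodule.mem_map_of_mem (hf n b hb)
          rw [← huspan] at h1
          have h2 := Submodule.mem_map_of_mem (f := Qs) h1
          rw [Submodule.map_span, ← Set.range_comp, hQs] at h2
          have h3 : (⇑Qs ∘ fun i => (decomposables ℬ).mkQ (f (u n i))) =
              fun i => (decomposables 𝒜).mkQ (u n i) := funext fun i => by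
            rw [Function.comp_apply, hQs, hs]
          rwa [h3] at h2
        · exact sub_mem hbp (map_mem_primitives s (map_mem_primitives f hbp))
        · exact sub_mem hb (hsgr n _ (hf n b hb))
        · change f (b - s (f b)) = 0
          rw [map_sub, hfs, sub_self]
  have hNfin : ∀ n, FiniteDimensional ℂ (N n) := fun n =>
    Submodule.finiteDimensional_of_le (le_sup_right.trans (hsup n).le)
  have hNrank : ∀ n, Module.finrank ℂ (N n) = Module.finrank ℂ (indecomposables 𝒜 n) - r n := by
    intro n
    have : FiniteDimensional ℂ (U n) := FiniteDimensional.span_of_finite ℂ (Set.finite_range _)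
    have h1 := Submodule.finrank_sup_add_finrank_inf_eq (U n) (N n)
    have h2 : Module.finrank ℂ (U n) = r n := by
      rw [finrank_span_eq_card (huli' n), Fintype.card_fin]
    rw [(hdisj n).eq_bot, finrank_bot, hsup, h2] at h1
    omega
  let bN n := Module.finBasisOfFinrankEq ℂ (N n) (hNrank n)
  have hz : ∀ n i, ∃ a ∈ primitives ℂ H ⊓ 𝒜 n ⊓ LinearMap.ker f'.toLinearMap,
      (decomposables 𝒜).mkQ a = (bN n i : H ⧸ decomposables 𝒜) := by
    intro n i
    have hi := (bN n i).2
    set b := (bN n i : H ⧸ decomposables 𝒜)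
    simp only [N] at hi
    split_ifs at hi with hn
    · exact ⟨0, zero_mem _, by rw [(Submodule.mem_bot ℂ).1 hi, map_zero]⟩
    · exact hi
  choose z hz hzb using hz
  have hzb' : ∀ n, (fun i => (decomposables 𝒜).mkQ (z n i)) = (N n).subtype ∘ bN n := fun n =>
    funext fun i => hzb n i
  have hzli : ∀ n, LinearIndependent ℂ fun i => (decomposables 𝒜).mkQ (z n i) := fun n => by
    rw [hzb']
    exact (bN n).linearIndependent.map' _ (Submodule.ker_subtype _)
  have hzspan : ∀ n, Submodule.span ℂ (Set.range fun i => (decomposables 𝒜).mkQ (z n i)) = N n :=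
    fun n => by
      rw [hzb', Set.range_comp, Submodule.span_image, Module.Basis.span_eq, Submodule.map_top,
        Submodule.range_subtype]
  have hsum : ∀ n, (fun i => (decomposables 𝒜).mkQ (Sum.elim (u n) (z n) i)) =
      Sum.elim (fun i => (decomposables 𝒜).mkQ (u n i)) (fun i => (decomposables 𝒜).mkQ (z n i)) :=
    fun n => by ext (i | i) <;> rfl
  refine ⟨u, z, fun n i => (hu n i).1, fun n i => (hz n i).1.1, fun n i => (hz n i).2, ?_, hy⟩
  refine hX.of_linearIndependent ?_ (fun n => inferInstance) ?_ (fun n _ => ?_) fun n hn => ?_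
  · have : IsEmpty (Fin (Module.finrank ℂ (indecomposables 𝒜 0) - r 0)) := by
      rw [indecomposables_zero, finrank_bot, Nat.zero_sub]
      infer_instance
    exact instIsEmptySum
  · rintro n (i | i)
    · exact (hu n i).2
    · exact (hz n i).1.2
  · rw [hsum]
    exact (huli' n).sum_type (hzli n) (by rw [hzspan]; exact hdisj n)
  · rw [hsum, Set.Sum.elim_range, Submodule.span_union, hzspan]
    refine (hsup n).trans ?_
    rw [indecomposables_of_pos _ hn]

end Adapted

/-! ### Surjective homomorphisms -/

theorem mainTheorem7 {H : Type u} {K : Type v}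
    [Ring H] [HopfAlgebra ℂ H] (𝒜 : ℕ → Submodule ℂ H) [GradedAlgebra 𝒜]
    [Ring K] [HopfAlgebra ℂ K] (ℬ : ℕ → Submodule ℂ K) [GradedAlgebra ℬ]
    (hH : IsFGCCHA H 𝒜) (hK : IsFGCCHA K ℬ)
    (f : H →ₐc[ℂ] K) (hf : IsGradedMap 𝒜 ℬ f) (hfs : Function.Surjective f) :
    (∃ S : HopfSubalgebra ℂ H, S.IsGraded 𝒜 ∧
      ∃ φ : K ≃ₐc[ℂ] S.toSubalgebra,
        IsGradedMap ℬ (S.grading 𝒜) φ ∧ IsGradedMap (S.grading 𝒜) ℬ φ.symm) ∧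
    (∀ g : H →ₐc[ℂ] K, IsGradedMap 𝒜 ℬ g → Function.Surjective g →
      ∃ γ : K ≃ₐc[ℂ] K, ∃ τ : H ≃ₐc[ℂ] H,
        (IsGradedMap ℬ ℬ γ ∧ IsGradedMap ℬ ℬ γ.symm) ∧
        (IsGradedMap 𝒜 𝒜 τ ∧ IsGradedMap 𝒜 𝒜 τ.symm) ∧
        g = (γ : K →ₐc[ℂ] K).comp (f.comp (τ : H →ₐc[ℂ] H))) := by
  obtain ⟨r, m, hrm⟩ := exists_adapted_generators 𝒜 ℬ hH hK
  obtain ⟨u, z, hu, hz, hfz, hX, hY⟩ := hrm f hf hfs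
  refine ⟨?_, fun g hg hgs => ?_⟩
  · obtain ⟨s, -, hfs, hsgr⟩ := exists_graded_section f hY hu fun n i => hX.mem n (Sum.inl i)
    let s' : K →ₐ[ℂ] H := s
    have hinj : Function.Injective s := Function.LeftInverse.injective hfs
    have hbij : Function.Bijective s.hopfRangeRestrict :=
      ⟨fun a b hab => hinj (congrArg Subtype.val hab), s.hopfRangeRestrict_surjective⟩
    refine ⟨s.hopfRange, ?_, BialgEquiv.ofBijective _ hbij, fun n b hb => hsgr n b hb, ?_⟩
    · rintro n _ ⟨b, rfl⟩
      exact ⟨DirectSum.decompose ℬ b n,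
        IsGradedMap.map_decompose (θ := s'.toLinearMap) hsgr b n⟩
    · intro n a ha
      refine IsGradedMap.mem_of_map_mem (θ := s'.toLinearMap) hsgr hinj ?_
      have : s.hopfRangeRestrict ((BialgEquiv.ofBijective _ hbij).symm a) = a :=
        (BialgEquiv.ofBijective _ hbij).apply_symm_apply a
      have h2 : s ((BialgEquiv.ofBijective _ hbij).symm a) = (a : H) := congrArg Subtype.val this
      exact h2.symm ▸ ha
  -- In each degree the generators for `g` have the same index types as those for `f`.
  · obtain ⟨u', z', hu', hz', hgz', hX', hY'⟩ := hrm g hg hgs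
    obtain ⟨γ, hγ, hγ1, hγ2⟩ := hY.exists_bialgEquiv (fun n i => map_mem_primitives f (hu n i))
      hY' (fun n i => map_mem_primitives g (hu' n i))
    obtain ⟨τ, hτ, hτ1, hτ2⟩ := hX'.exists_bialgEquiv
      (by rintro n (i | i); exacts [hu' n i, hz' n i]) hX
      (by rintro n (i | i); exacts [hu n i, hz n i])
    refine ⟨γ, τ, ⟨hγ1, hγ2⟩, ⟨hτ1, hτ2⟩, hX'.bialgHom_ext ?_⟩
    rintro n (i | i)
    · have h1 : τ (u' n i) = u n i := hτ n (Sum.inl i)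
      simp [h1, hγ]
    · have h1 : τ (z' n i) = z n i := hτ n (Sum.inr i)
      simp [h1, hfz, hgz']
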